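/- A word $\pi_1\pi_2\cdots\pi_r$ of positive integers has a *descent* at $i\in\{1,\dots,r\}$ if $\pi_i>\pi_{i+1}$ or $i=r$; let $\mathrm{des}(\pi)$ be its number of descents. For $n\ge 0$, let $\overline{\mathcal Q}_n$ be the set of *quasi-Stirling permutations* of size $n$, that is, the permutations $\pi_1\pi_2\cdots\pi_{2n}$ of the multiset $\{1,1,2,2,\dots,n,n\}$ that avoid the patterns $1212$ and $2121$ (equivalently, there are no $i<j<k<\ell$ with $\pi_i=\pi_k$ and $\pi_j=\pi_\ell$), and let $$\overline{Q}_n(t)=\sum_{\pi\in\overline{\mathcal Q}_n}t^{\mathrm{des}(\pi)}$$ be the quasi-Stirling polynomial. **Theorem.** For every integer $n\ge 0$, as formal power series in $t$ with rational coefficients (with the convention $0^0=1$), $$\sum_{m\ge 0}\frac{m^n}{n+1}\binom{m+n}{m}\,t^m=\frac{\overline{Q}_n(t)}{(1-t)^{2n+1}}.$$ -/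

import Mathlib

open scoped Polynomial PowerSeries

namespace QuasiStirling

/-- The number of descents of a word `π₁π₂…π_r`: the number of `i ∈ {1, …, r}` such that
`π_i > π_{i+1}` or `i = r`. The last position always counts, so a one-letter word has one descent;
the empty word has none. -/
def des : List ℕ → ℕ
  | [] => 0
  | [_] => 1
  | a :: b :: l => (if b < a then 1 else 0) + des (b :: l)

/-- The word `π` avoids the patterns `1212` and `2121`: for `a < b`, neither `a b a b` nor
`b a b a` is a subsequence of `π` (subsequences need not be contiguous). -/
def Avoids (π : List ℕ) : Prop :=
  ∀ a b : ℕ, a < b → ¬ [a, b, a, b].Sublist π ∧ ¬ [b, a, b, a].Sublist π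

/-- The multiset `{1, 1, 2, 2, …, n, n}`. -/
def doubled (n : ℕ) : Multiset ℕ := 2 • (Finset.Icc 1 n).val

open Classical in
/-- The set of quasi-Stirling permutations of size `n`: the permutations (orderings) of the
multiset `{1, 1, 2, 2, …, n, n}` that avoid `1212` and `2121`. -/
noncomputable def quasiStirling (n : ℕ) : Finset (List ℕ) :=
  (doubled n).lists.toFinset.filter Avoids

/-- The quasi-Stirling polynomial of index `n`, the descent enumerator of the quasi-Stirling
permutations of size `n`. -/
noncomputable def quasiStirlingPoly (n : ℕ) : ℚ[X] :=
  ∑ π ∈ quasiStirling n, (Polynomial.X : ℚ[X]) ^ des π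

end QuasiStirling

/-! Let `n > 0`. Dividing `t ^ des π` by `(1 - t) ^ (2n + 1)` gives the generating series of
`numCompatible π m` (`mk_numCompatible_mul`), so the coefficient of `t ^ m` on the right counts
pairs `(π, g)` with `g` compatible with `π`. Encoding position `k` as `(m - 1 - g_k) n + (π_k - 1)`
makes such a pair a weakly increasing word in `[0, mn)` that uses each residue mod `n` twice.
Residue `i` spans an arc from block `a i` to block `b i`, and avoiding 1212 and 2121 means that no
two arcs cross (`sum_card_lifts`).

Noncrossing arcs are the sojourns of customers in a preemptive last-in-first-out queue: left
endpoints are arrivals, and the time an arc is innermost is the service received, necessarily a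
multiple `n * x i`. Arrivals and services determine the departures and conversely, and all
departures fall before `mn` exactly under a parking condition on `(a, x)`
(`card_noncrossing_eq_card_parking`).

By the cycle lemma, for `m > 0` a fixed `x` admits `m ^ (n - 1) * max (m - ∑ x i) 0` choices of `a`
(`card_parking`). Summing over `x` gives `m ^ (n - 1) * C(m + n, n + 1)`, which is `m ^ n / (n + 1)
* C(m + n, m)`. -/

namespace QuasiStirling

/-! ### Laminar intervals and the last-in-first-out queue -/

section Queue

variable {ι : Type*} [Fintype ι]

/-- The total service requirement `y` of the customers arriving (at times `p`) in `[s, t]`. -/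
def work (p y : ι → ℕ) (s t : ℕ) : ℕ := ∑ j with s ≤ p j ∧ p j ≤ t, y j

theorem work_mono (p y : ι → ℕ) (s : ℕ) {t t' : ℕ} (h : t ≤ t') : work p y s t ≤ work p y s t' :=
  Finset.sum_le_sum_of_subset (fun j hj => by simp at hj ⊢; omega)

theorem exists_work_le (p y : ι → ℕ) (s : ℕ) : ∃ d, work p y s (s + d) ≤ d :=
  ⟨∑ j, y j, Finset.sum_le_sum_of_subset (Finset.subset_univ _)⟩

/-- The departure time of customer `i` in a queue served last-in-first-out with preemption. -/
def departure (p y : ι → ℕ) (i : ι) : ℕ := p i + Nat.find (exists_work_le p y (p i))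

/-- The intervals `[p i, q i]` are pairwise disjoint or nested. -/
def Laminar (p q : ι → ℕ) : Prop :=
  (∀ i, p i ≤ q i) ∧ ∀ i j, p i < p j → q i < p j ∨ q j ≤ q i

/-- Every sojourn time is the total service requirement of the arrivals during the sojourn. -/
def Balanced (p q y : ι → ℕ) : Prop := ∀ i, p i + work p y (p i) (q i) = q i

/-- The number of time units at which `i` is the innermost of the intervals `[p i, q i)`. -/
def exclusive (p q : ι → ℕ) (i : ι) : ℕ :=
  ((Finset.Ico (p i) (q i)).filter fun u => ∀ j, p j ≤ u → u < q j → p j ≤ p i).card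

/-- One time unit before departure the work still exceeds the elapsed time, and work never
decreases; hence equality at departure. -/
theorem departure_balanced (p y : ι → ℕ) : Balanced p (departure p y) y := by
  intro i
  have h1 := Nat.find_spec (exists_work_le p y (p i))
  have h2 := fun d => Nat.find_min (m := d) (exists_work_le p y (p i))
  unfold departure
  generalize Nat.find (exists_work_le p y (p i)) = d at *
  rcases d with _ | d
  · omega
  · have := h2 d (by omega)
    have := work_mono p y (p i) (show p i + d ≤ p i + (d + 1) by omega)
    omega

theorem lt_work_of_lt_departure {p y : ι → ℕ} {i : ι} {t : ℕ} (h1 : p i ≤ t)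
    (h2 : t < departure p y i) : t < p i + work p y (p i) t := by
  have := Nat.find_min (m := t - p i) (exists_work_le p y (p i)) (by unfold departure at h2; omega)
  rw [show p i + (t - p i) = t by omega] at this
  omega

theorem departure_le {p y : ι → ℕ} {i : ι} {t : ℕ} (h1 : p i ≤ t)
    (h2 : p i + work p y (p i) t ≤ t) : departure p y i ≤ t := by
  by_contra h
  have := lt_work_of_lt_departure h1 (not_le.1 h)
  omega

theorem work_split (p y : ι → ℕ) {s r t : ℕ} (h1 : s ≤ r + 1) (h2 : r ≤ t) :
    work p y s t = work p y s r + work p y (r + 1) t := by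
  classical
  unfold work
  rw [← Finset.sum_union]
  · congr 1; ext j; simp; omega
  · rw [Finset.disjoint_left]; intro j; simp; omega

/-- When `j` arrives during the sojourn of `i`, earlier work is still pending, so the work from `j`
onwards fits into the time left to `i`, and `j` leaves no later than `i`. -/
theorem departure_laminar (p y : ι → ℕ) : Laminar p (departure p y) := by
  refine ⟨fun i => by unfold departure; omega, fun i j hij => ?_⟩
  by_contra! h
  obtain ⟨h1, h2⟩ := h
  have hb := departure_balanced p y i
  have h3 := lt_work_of_lt_departure (i := i) (t := p j - 1) (by omega) (by omega)
    (p := p) (y := y)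
  have h4 := work_split p y (s := p i) (r := p j - 1) (t := departure p y i) (by omega) (by omega)
  rw [show p j - 1 + 1 = p j by omega] at h4
  have := departure_le (p := p) (y := y) (i := j) h1 (by omega)
  omega

theorem departure_le_of_work_le {p y : ι → ℕ} {T : ℕ}
    (h : ∀ i, p i + ∑ j with p i ≤ p j, y j ≤ T) (i : ι) : departure p y i ≤ T := by
  refine departure_le (by have := h i; omega) (le_trans ?_ (h i))
  exact Nat.add_le_add_left (Finset.sum_le_sum_of_subset (fun j hj => by simp at hj ⊢; omega)) _

/-- Induction on the arrivals, latest first. -/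
theorem latest_first {p : ι → ℕ} {P : ι → Prop} (h : ∀ i, (∀ j, p i < p j → P j) → P i) (i : ι) :
    P i := by
  let B := ∑ j, p j
  have hB : ∀ j, p j ≤ B := fun j => Finset.single_le_sum (by simp) (Finset.mem_univ j)
  induction hk : B - p i using Nat.strong_induction_on generalizing i with
  | _ k ih =>
    exact h i fun j hj => ih (B - p j) (by have := hB j; omega) j rfl

theorem work_self {p : ι → ℕ} (hp : Function.Injective p) (y : ι → ℕ) {i : ι} {t : ℕ}
    (h : p i ≤ t) : work p y (p i) t = y i + work p y (p i + 1) t := by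
  rw [work_split p y (s := p i) (r := p i) (by omega) h]
  congr 1
  unfold work
  rw [Finset.sum_eq_single i]
  · intro j hj hji
    simp at hj
    exact absurd (hp (le_antisymm hj.2 hj.1)) hji
  · simp

/-- The balance equations are triangular: each `y i` is the sojourn time minus services of later
arrivals. -/
theorem Balanced.unique {p q y y' : ι → ℕ} (hp : Function.Injective p) (hq : ∀ i, p i ≤ q i)
    (h : Balanced p q y) (h' : Balanced p q y') : y = y' := by
  funext i
  refine latest_first (p := p) (P := fun i => y i = y' i) (fun i ih => ?_) i
  have e1 := h i
  have e2 := h' i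
  rw [work_self hp _ (hq i)] at e1 e2
  have : work p y (p i + 1) (q i) = work p y' (p i + 1) (q i) :=
    Finset.sum_congr rfl fun j hj => ih j (by simp at hj; omega)
  omega

theorem Balanced.dvd {p q y : ι → ℕ} (hp : Function.Injective p) (hq : ∀ i, p i ≤ q i)
    (h : Balanced p q y) {n : ℕ} (hn : ∀ i, n ∣ q i - p i) (i : ι) : n ∣ y i := by
  refine latest_first (p := p) (P := fun i => n ∣ y i) (fun i ih => ?_) i
  have e1 := h i
  rw [work_self hp _ (hq i)] at e1
  have h1 : n ∣ work p y (p i + 1) (q i) :=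
    Finset.dvd_sum fun j hj => ih j (by simp at hj; omega)
  have h2 := hn i
  rw [show q i - p i = y i + work p y (p i + 1) (q i) by omega] at h2
  exact (Nat.dvd_add_left h1).1 h2

/-- The sum of the exclusive times over a set of intervals counts the times at which the innermost
interval belongs to that set. -/
theorem sum_exclusive {p : ι → ℕ} (hp : Function.Injective p) (q : ι → ℕ) (s : Finset ι) :
    ∃ U : Finset ℕ, ∑ j ∈ s, exclusive p q j = U.card ∧
      ∀ u, u ∈ U ↔ ∃ j ∈ s, p j ≤ u ∧ u < q j ∧ ∀ k, p k ≤ u → u < q k → p k ≤ p j := by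
  refine ⟨s.biUnion fun i =>
    (Finset.Ico (p i) (q i)).filter fun u => ∀ j, p j ≤ u → u < q j → p j ≤ p i, ?_, ?_⟩
  · rw [Finset.card_biUnion]
    · rfl
    · intro i _ j _ hij
      rw [Function.onFun, Finset.disjoint_left]
      intro u hu hu'
      simp only [Finset.mem_filter, Finset.mem_Ico] at hu hu'
      exact hij (hp (le_antisymm (hu'.2 i hu.1.1 hu.1.2) (hu.2 j hu'.1.1 hu'.1.2)))
  · intro u
    simp [and_assoc]

theorem exists_innermost {p q : ι → ℕ} {i : ι} {u : ℕ} (h1 : p i ≤ u) (h2 : u < q i) :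
    ∃ j, p i ≤ p j ∧ p j ≤ u ∧ u < q j ∧ ∀ k, p k ≤ u → u < q k → p k ≤ p j := by
  classical
  obtain ⟨j, hj, hmax⟩ := Finset.exists_max_image
    (Finset.univ.filter fun k => p k ≤ u ∧ u < q k) p ⟨i, by simp [h1, h2]⟩
  simp at hj hmax
  exact ⟨j, hmax i h1 h2, hj.1, hj.2, fun k h h' => hmax k h h'⟩

/-- By laminarity, the time units of `[p i, q i)` are exactly those whose innermost interval starts
in `[p i, q i]`. -/
theorem Laminar.balanced {p q : ι → ℕ} (hp : Function.Injective p) (h : Laminar p q) :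
    Balanced p q (exclusive p q) := by
  intro i
  obtain ⟨U, hU, hmem⟩ := sum_exclusive hp q (Finset.univ.filter fun j => p i ≤ p j ∧ p j ≤ q i)
  have : U = Finset.Ico (p i) (q i) := by
    ext u
    rw [hmem, Finset.mem_Ico]
    constructor
    · rintro ⟨j, hj, h1, h2, -⟩
      simp at hj
      refine ⟨hj.1.trans h1, ?_⟩
      rcases hj.1.eq_or_lt with e | e
      · rwa [hp e]
      · rcases h.2 i j e with h' | h' <;> omega
    · rintro ⟨h1, h2⟩
      obtain ⟨j, g1, g2, g3, g4⟩ := exists_innermost h1 h2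
      exact ⟨j, by simp; omega, g2, g3, g4⟩
  rw [work, hU, this, Nat.card_Ico]
  have := h.1 i
  omega

theorem Laminar.departure_exclusive {p q : ι → ℕ} (hp : Function.Injective p) (h : Laminar p q) :
    departure p (exclusive p q) = q := by
  funext i
  have hb := h.balanced hp i
  refine le_antisymm (departure_le (h.1 i) hb.le) ?_
  by_contra! hlt
  set t := departure p (exclusive p q) i with ht
  have hpt : p i ≤ t := (departure_laminar p _).1 i
  have hbt : p i + work p (exclusive p q) (p i) t = t := departure_balanced p _ i
  obtain ⟨U, hU, hmem⟩ := sum_exclusive hp q (Finset.univ.filter fun j => p i ≤ p j ∧ p j ≤ t)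
  -- If `t < q i`, all `t - p i + 1` units of `[p i, t]` are served to arrivals in `[p i, t]`: one
  -- more than the balance at `t` allows.
  have hsub : Finset.Icc (p i) t ⊆ U := by
    intro u hu
    rw [Finset.mem_Icc] at hu
    obtain ⟨j, g1, g2, g3, g4⟩ := exists_innermost hu.1 (lt_of_le_of_lt hu.2 hlt)
    exact (hmem u).2 ⟨j, by simp; omega, g2, g3, g4⟩
  have := Finset.card_le_card hsub
  rw [Nat.card_Icc, ← hU] at this
  unfold work at hbt
  omega

/-- The counted time units are distinct and lie in `[p i, T)`. This is the converse to
`departure_le_of_work_le`. -/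
theorem exclusive_work_le {p q : ι → ℕ} (hp : Function.Injective p) {T : ℕ} (hpq : ∀ i, p i ≤ q i)
    (hT : ∀ i, q i ≤ T) (i : ι) : p i + ∑ j with p i ≤ p j, exclusive p q j ≤ T := by
  obtain ⟨U, hU, hmem⟩ := sum_exclusive hp q (Finset.univ.filter fun j => p i ≤ p j)
  have hsub : U ⊆ Finset.Ico (p i) T := by
    intro u hu
    obtain ⟨j, hj, h1, h2, -⟩ := (hmem u).1 hu
    simp at hj
    have := hT j
    rw [Finset.mem_Ico]; omega
  have := Finset.card_le_card hsub
  rw [Nat.card_Ico, ← hU] at this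
  have := hpq i
  have := hT i
  omega

theorem exclusive_departure {p : ι → ℕ} (hp : Function.Injective p) (y : ι → ℕ) :
    exclusive p (departure p y) = y :=
  ((departure_laminar p y).balanced hp).unique hp (departure_laminar p y).1
    (departure_balanced p y)

end Queue

/-! ### The cycle lemma and weighted parking functions -/

section CycleLemma

/-- The cycle lemma: if `S` has period increment `X ≥ 0` and steps at most `1`, then `X` of the
indices in a period are such that all later values are larger. -/
theorem card_forall_lt_eq (S : ℕ → ℤ) (m : ℕ) (X : ℕ) (hm : 0 < m)
    (hper : ∀ c, S (c + m) = S c + X) (hstep : ∀ c, S (c + 1) ≤ S c + 1) :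
    ((Finset.range m).filter fun c => ∀ k < m, S c < S (c + 1 + k)).card = X := by
  have hne : (Finset.range m).Nonempty := ⟨0, by simpa using hm⟩
  -- Minimum of `S` over the window `[c, c + m)`. Sliding the window raises it by 1 exactly at the
  -- indices to be counted and otherwise leaves it fixed, so the count telescopes to `M m - M 0 =
  -- X`.
  let M : ℕ → ℤ := fun c => (Finset.range m).inf' hne fun k => S (c + k)
  have hM : ∀ c x, x ≤ M c ↔ ∀ k < m, x ≤ S (c + k) := by
    intro c x; simp [M, Finset.le_inf'_iff]
  have hMper : M m = M 0 + X := by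
    apply le_antisymm
    · rw [← sub_le_iff_le_add, hM]
      intro k hk
      have := (hM m _).1 le_rfl k hk
      rw [add_comm m k, hper] at this
      rw [zero_add]; linarith
    · rw [hM]
      intro k hk
      have := (hM 0 _).1 le_rfl k hk
      rw [add_comm m k, hper]
      rw [zero_add] at this; linarith
  have hle : ∀ c, M c ≤ M (c + 1) := by
    intro c
    rw [hM]
    intro k hk
    rcases Nat.lt_or_ge (k + 1) m with h | h
    · have := (hM c _).1 le_rfl (k + 1) h
      rwa [show c + 1 + k = c + (k + 1) by ring]
    · have e : k + 1 = m := by omega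
      have := (hM c _).1 le_rfl 0 hm
      rw [show c + 1 + k = c + m by omega, hper]
      simp at this; linarith
  have hdiff : ∀ c, M (c + 1) - M c = if ∀ k < m, S c < S (c + 1 + k) then 1 else 0 := by
    intro c
    have h0 : M c ≤ S c := (hM c _).1 le_rfl 0 hm
    split_ifs with h
    · have h1 : S c + 1 ≤ M (c + 1) := by rw [hM]; intro k hk; have := h k hk; omega
      have h2 : M (c + 1) ≤ S (c + 1) := (hM _ _).1 le_rfl 0 hm
      have h3 := hstep c
      have h4 : S c ≤ M c := by
        rw [hM]
        intro k hk
        rcases k with _ | k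
        · simp
        · have := h k (by omega)
          rw [show c + (k + 1) = c + 1 + k by ring]; omega
      omega
    · push Not at h
      obtain ⟨k, hk, h⟩ := h
      have h1 : M (c + 1) ≤ M c := by
        have h2 : M (c + 1) ≤ S c := ((hM _ _).1 le_rfl k hk).trans h
        rw [hM]
        intro k' hk'
        rcases k' with _ | k'
        · simpa using h2
        · have := (hM (c + 1) _).1 le_rfl k' (by omega)
          rwa [show c + (k' + 1) = c + 1 + k' by ring]
      have := hle c
      omega
  have := Finset.sum_range_sub M m
  rw [Finset.sum_congr rfl fun c _ => hdiff c, hMper, Finset.sum_boole] at this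
  have h2 : (((Finset.range m).filter fun c => ∀ k < m, S c < S (c + 1 + k)).card : ℤ) = X := by
    linarith
  exact_mod_cast h2

theorem card_cyclic_shifts (m : ℕ) [NeZero m] (w : ZMod m → ℕ) :
    ((Finset.univ : Finset (ZMod m)).filter fun c =>
      ∀ r < m, ∑ k ∈ Finset.range (r + 1), w (c + k) ≤ r).card = m - ∑ z, w z := by
  have hm : 0 < m := Nat.pos_of_ne_zero (NeZero.ne m)
  have hsum : ∀ c : ZMod m, ∑ k ∈ Finset.range m, w (c + k) = ∑ z, w z := by
    intro c
    rw [← Equiv.sum_comp (Equiv.addLeft c) w]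
    refine Finset.sum_bij' (fun k _ => (k : ZMod m)) (fun z _ => z.val) ?_ ?_ ?_ ?_ ?_
    · simp
    · intro z _; simpa using ZMod.val_lt z
    · intro k hk; exact ZMod.val_cast_of_lt (by simpa using hk)
    · intro z _; simp
    · simp
  rcases le_total (∑ z, w z) m with h | h
  -- With steps `1 - w`, the bound `∑ ≤ r` on `r + 1` terms from `c` says `S c < S (c + 1 + r)`.
  · let S : ℕ → ℤ := fun c => ∑ k ∈ Finset.range c, (1 - (w (k : ZMod m) : ℤ))
    have hS : ∀ c r, S (c + r) = S c + r - (∑ k ∈ Finset.range r, w ((c : ZMod m) + k) : ℕ) := by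
      intro c r
      simp only [S, Finset.sum_range_add, Finset.sum_sub_distrib]
      push_cast
      simp
      ring
    rw [← card_forall_lt_eq S m (m - ∑ z, w z) hm]
    · refine Finset.card_bij' (fun z _ => z.val) (fun k _ => (k : ZMod m)) ?_ ?_ ?_ ?_
      · intro c hc
        simp only [Finset.mem_filter, Finset.mem_univ, true_and, Finset.mem_range] at hc ⊢
        refine ⟨ZMod.val_lt c, fun k hk => ?_⟩
        have := hc k hk
        rw [add_assoc, hS]
        rw [add_comm 1 k]
        simp only [ZMod.natCast_val, ZMod.cast_id', id_eq] at this ⊢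
        omega
      · intro c hc
        simp only [Finset.mem_filter, Finset.mem_univ, true_and, Finset.mem_range] at hc ⊢
        intro k hk
        have := hc.2 k hk
        rw [add_assoc, hS, add_comm 1 k] at this
        omega
      · intro z _; simp
      · intro k hk
        simp only [Finset.mem_filter, Finset.mem_range] at hk
        exact ZMod.val_cast_of_lt hk.1
    · intro c; rw [hS, hsum]; omega
    · intro c; rw [hS]; omega
  · rw [Nat.sub_eq_zero_of_le h, Finset.card_eq_zero, Finset.filter_eq_empty_iff]
    intro c _ hc
    have := hc (m - 1) (by omega)
    rw [show m - 1 + 1 = m by omega, hsum] at this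
    omega

/-- The number of weighted parking functions. -/
theorem card_parking (n m : ℕ) [NeZero m] (x : Fin n → ℕ) :
    m * ((Finset.univ : Finset (Fin n → ZMod m)).filter fun b =>
      ∀ r < m, ∑ i with (b i).val ≤ r, x i ≤ r).card = m ^ n * (m - ∑ i, x i) := by
  let G : (Fin n → ZMod m) → Prop := fun b => ∀ r < m, ∑ i with (b i).val ≤ r, x i ≤ r
  have h1 : ∀ c : ZMod m, (Finset.univ.filter fun b : Fin n → ZMod m => G (fun i => b i - c)).card =
      (Finset.univ.filter G).card := by
    intro c
    refine Finset.card_bij' (fun b _ i => b i - c) (fun b _ i => b i + c) ?_ ?_ ?_ ?_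
    · intro b hb; simpa using hb
    · intro b hb; simpa using hb
    · intro b _; simp
    · intro b _; simp
  have h2 : ∀ b : Fin n → ZMod m,
      (Finset.univ.filter fun c => G (fun i => b i - c)).card = m - ∑ i, x i := by
    intro b
    have e := card_cyclic_shifts m (fun z => ∑ i with b i = z, x i)
    rw [Finset.sum_fiberwise] at e
    rw [← e]
    congr 1
    ext c
    simp only [Finset.mem_filter, Finset.mem_univ, true_and, G]
    refine forall₂_congr fun r hr => ?_
    have : ∑ i with (b i - c).val ≤ r, x i =
        ∑ k ∈ Finset.range (r + 1), ∑ i with b i = c + k, x i := by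
      rw [← Finset.sum_fiberwise_of_maps_to (s := Finset.univ.filter fun i => (b i - c).val ≤ r)
        (t := Finset.range (r + 1)) (g := fun i => (b i - c).val)
        (by intro i hi; simp at hi ⊢; omega)]
      refine Finset.sum_congr rfl fun k hk => Finset.sum_congr ?_ fun _ _ => rfl
      ext i
      simp only [Finset.mem_filter, Finset.mem_univ, true_and, Finset.mem_range] at hk ⊢
      constructor
      · rintro ⟨-, h⟩
        rw [← h]; simp
      · intro h
        have : (b i - c).val = k := by rw [h]; simpa using ZMod.val_cast_of_lt (by omega)
        omega
    rw [this]
  -- Double count the pairs `(b, c)` for which `b` translated by `-c` is good: every `c` has equally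
  -- many `b`, and every `b` has `m - ∑ x i` values of `c`.
  have h3 := Finset.sum_card_bipartiteAbove_eq_sum_card_bipartiteBelow
    (s := (Finset.univ : Finset (Fin n → ZMod m))) (t := (Finset.univ : Finset (ZMod m)))
    (fun b c => G (fun i => b i - c))
  simp only [Finset.bipartiteAbove, Finset.bipartiteBelow, h1, h2] at h3
  simp [ZMod.card] at h3
  exact h3.symm

/-- Truncated subtraction kills the terms with large entries, so the range `M` may stay fixed while
the induction lowers `m`; each step is a hockey-stick sum. -/
theorem sum_sub_sum (n : ℕ) {m M : ℕ} (h : m ≤ M) :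
    ∑ x : Fin n → Fin M, (m - ∑ i, (x i : ℕ)) = (m + n).choose (n + 1) := by
  induction n generalizing m with
  | zero => simp
  | succ n ih =>
    rw [← Equiv.sum_comp (Fin.consEquiv fun _ => Fin M), Fintype.sum_prod_type]
    simp only [Fin.consEquiv_apply, Fin.sum_univ_succ, Fin.cons_zero, Fin.cons_succ, ← Nat.sub_sub]
    have : ∀ a : Fin M, ∑ x : Fin n → Fin M, (m - (a : ℕ) - ∑ i, (x i : ℕ)) =
        (m - a + n).choose (n + 1) := fun a => ih (by omega)
    rw [Finset.sum_congr rfl fun a _ => this a,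
      Fin.sum_univ_eq_sum_range (fun a => (m - a + n).choose (n + 1)) M]
    obtain ⟨d, rfl⟩ := Nat.exists_eq_add_of_le h
    rw [Finset.sum_range_add, Finset.sum_eq_zero (s := Finset.range d), add_zero]
    · clear ih this h
      induction m with
      | zero => simp
      | succ m ihm =>
        rw [Finset.sum_range_succ']
        simp only [Nat.add_sub_add_right, ihm, Nat.sub_zero]
        rw [show m + 1 + (n + 1) = (m + (n + 1)) + 1 by ring, Nat.choose_succ_succ (m + (n + 1)),
          add_comm, show m + 1 + n = m + (n + 1) by ring]
    · intro k _
      exact Nat.choose_eq_zero_of_lt (by omega)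

end CycleLemma

/-! ### Compatible words and their lifts to increasing words -/

section Lifts

/-- The number of weakly decreasing words `g` over `{0, …, r - 1}` of the length of `π` that
decrease strictly at every descent of `π` other than the last position. -/
def numCompatible : List ℕ → ℕ → ℕ
  | [], _ => 1
  | [_], r => r
  | a :: b :: l, r => ∑ g ∈ Finset.range r, numCompatible (b :: l) (if b < a then g else g + 1)

theorem coeff_succ_one_sub_X_mul (F : ℚ⟦X⟧) (r : ℕ) :
    PowerSeries.coeff (r + 1) ((1 - PowerSeries.X) * F) =
      PowerSeries.coeff (r + 1) F - PowerSeries.coeff r F := by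
  rw [sub_mul, one_mul, map_sub, PowerSeries.coeff_succ_X_mul]

theorem numCompatible_zero (a : ℕ) (l : List ℕ) : numCompatible (a :: l) 0 = 0 := by
  cases l <;> simp [numCompatible]

/-- Each factor `1 - X` undoes the summation over one letter, leaving a factor `X` at a descent. The
last letter has series `∑ r X ^ r = X / (1 - X) ^ 2`, hence the exponent `length + 1`. -/
theorem mk_numCompatible_mul (a : ℕ) (l : List ℕ) :
    (1 - PowerSeries.X : ℚ⟦X⟧) ^ (l.length + 2) *
      PowerSeries.mk (fun r => (numCompatible (a :: l) r : ℚ)) = PowerSeries.X ^ des (a :: l) := by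
  induction l generalizing a with
  | nil =>
    rw [List.length_nil, zero_add, pow_two, mul_assoc]
    ext r
    rcases r with _ | _ | r
    · simp [des, numCompatible]
    · simp [des, numCompatible, coeff_succ_one_sub_X_mul]
    · simp only [coeff_succ_one_sub_X_mul, des, numCompatible, PowerSeries.coeff_mk, pow_one]
      rw [PowerSeries.coeff_X, if_neg (by omega)]
      push_cast
      ring
  | cons b l ih =>
    have key : (1 - PowerSeries.X : ℚ⟦X⟧) *
        PowerSeries.mk (fun r => (numCompatible (a :: b :: l) r : ℚ)) =
        PowerSeries.X ^ (if b < a then 1 else 0) *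
          PowerSeries.mk (fun r => (numCompatible (b :: l) r : ℚ)) := by
      ext r
      rcases r with _ | r
      · split_ifs <;> simp [numCompatible_zero]
      · rw [coeff_succ_one_sub_X_mul]
        simp only [PowerSeries.coeff_mk, numCompatible, Finset.sum_range_succ]
        split_ifs
        · rw [pow_one, PowerSeries.coeff_succ_X_mul]; simp
        · simp
    rw [List.length_cons, show l.length + 1 + 2 = (l.length + 2) + 1 by ring, pow_succ, mul_assoc,
      key, mul_left_comm, ih, ← pow_add]
    rfl

/-- The weakly increasing words `w` with entries in `[lo, T)` such that `π` is the word of the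
residues of the entries modulo `n`, increased by one. -/
def lifts (n T : ℕ) : ℕ → List ℕ → Finset (List ℕ)
  | _, [] => {[]}
  | lo, a :: l => ((Finset.Ico lo T).filter fun t => t % n + 1 = a).biUnion fun t =>
      (lifts n T t l).image (t :: ·)

theorem mem_lifts {n T lo : ℕ} {π w : List ℕ} : w ∈ lifts n T lo π ↔
    w.map (fun t => t % n + 1) = π ∧ w.Pairwise (· ≤ ·) ∧ ∀ t ∈ w, lo ≤ t ∧ t < T := by
  induction π generalizing lo w with
  | nil =>
    simp only [lifts, Finset.mem_singleton, List.map_eq_nil_iff]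
    constructor
    · rintro rfl; simp
    · exact fun h => h.1
  | cons a l ih =>
    simp only [lifts, Finset.mem_biUnion, Finset.mem_filter, Finset.mem_Ico, Finset.mem_image, ih]
    constructor
    · rintro ⟨t, ⟨⟨h1, h2⟩, h3⟩, w, ⟨h4, h5, h6⟩, rfl⟩
      refine ⟨by simp [h3, h4], List.pairwise_cons.2 ⟨fun s hs => (h6 s hs).1, h5⟩, ?_⟩
      intro s hs
      rcases List.mem_cons.1 hs with rfl | hs
      · exact ⟨h1, h2⟩
      · exact ⟨h1.trans (h6 s hs).1, (h6 s hs).2⟩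
    · rintro ⟨h1, h2, h3⟩
      rcases w with _ | ⟨t, w⟩
      · simp at h1
      · simp only [List.map_cons, List.cons.injEq] at h1
        rw [List.pairwise_cons] at h2
        exact ⟨t, ⟨h3 t (by simp), h1.1⟩, w,
          ⟨h1.2, h2.2, fun s hs => ⟨h2.1 s hs, (h3 s (by simp [hs])).2⟩⟩, rfl⟩

theorem card_lifts_cons (n T lo a : ℕ) (l : List ℕ) : (lifts n T lo (a :: l)).card =
    ∑ t ∈ (Finset.Ico lo T).filter (fun t => t % n + 1 = a), (lifts n T t l).card := by
  rw [lifts, Finset.card_biUnion]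
  · exact Finset.sum_congr rfl fun t _ =>
      Finset.card_image_of_injective _ (List.cons_injective)
  · intro s _ t _ hst
    rw [Function.onFun, Finset.disjoint_left]
    intro w hw hw'
    rw [Finset.mem_image] at hw hw'
    obtain ⟨u, -, rfl⟩ := hw
    obtain ⟨v, -, h⟩ := hw'
    exact hst (List.cons.inj h).1.symm

theorem mul_add_le_mul_add_iff {n k k' i j : ℕ} (hi : i < n) (hj : j < n) :
    k * n + i ≤ k' * n + j ↔ k < k' ∨ k = k' ∧ i ≤ j := by
  rcases lt_trichotomy k k' with h | rfl | h
  · have := Nat.mul_le_mul_right n (show k + 1 ≤ k' by omega)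
    rw [add_mul] at this
    simp only [h, true_or, iff_true]; omega
  · simp
  · have := Nat.mul_le_mul_right n (show k' + 1 ≤ k by omega)
    rw [add_mul] at this
    have e1 : ¬ (k < k') := by omega
    have e2 : k ≠ k' := by omega
    simp only [e1, e2, false_and, or_false, iff_false]; omega

theorem filter_Ico_eq_image {n m k i b : ℕ} (hi : i < n) (hb : b < n) (hk : k < m) :
    (Finset.Ico (k * n + i) (m * n)).filter (fun t => t % n + 1 = b + 1) =
      (Finset.range (if b < i then m - 1 - k else m - 1 - k + 1)).image
        fun g => (m - 1 - g) * n + b := by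
  ext t
  simp only [Finset.mem_filter, Finset.mem_Ico, Finset.mem_image, Finset.mem_range]
  constructor
  · rintro ⟨⟨h1, h2⟩, h3⟩
    have e := Nat.div_add_mod' t n
    rw [show t % n = b by omega] at e
    have h4 : t / n < m := Nat.div_lt_of_lt_mul (by rwa [mul_comm])
    rw [← e, mul_add_le_mul_add_iff hi hb] at h1
    refine ⟨m - 1 - t / n, by split_ifs <;> omega, ?_⟩
    rw [show m - 1 - (m - 1 - t / n) = t / n by omega, e]
  · rintro ⟨g, hg, rfl⟩
    refine ⟨⟨(mul_add_le_mul_add_iff hi hb).2 (by split_ifs at hg <;> omega), ?_⟩, ?_⟩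
    · have := Nat.mul_le_mul_right n (show m - 1 - g + 1 ≤ m by omega)
      rw [add_mul] at this; omega
    · rw [Nat.mul_add_mod', Nat.mod_eq_of_lt hb]

/-- The lower bound `lo` matters only through the admissible first entries, so the induction carries
`hlo` in its place, with `g` the block index counted from the right. -/
theorem card_lifts_aux {n m lo r a : ℕ} {l : List ℕ} (hr : r ≤ m) (ha : a < n)
    (hl : ∀ c ∈ l, 1 ≤ c ∧ c ≤ n)
    (hlo : (Finset.Ico lo (m * n)).filter (fun t => t % n + 1 = a + 1) =
      (Finset.range r).image fun g => (m - 1 - g) * n + a) :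
    (lifts n (m * n) lo ((a + 1) :: l)).card = numCompatible ((a + 1) :: l) r := by
  have hinj : Set.InjOn (fun g => (m - 1 - g) * n + a) (Finset.range r : Set ℕ) := by
    intro g hg g' hg' h
    simp only [Finset.coe_range, Set.mem_Iio] at hg hg'
    have := Nat.eq_of_mul_eq_mul_right (by omega) (Nat.add_right_cancel h)
    omega
  induction l generalizing a lo r with
  | nil =>
    rw [card_lifts_cons, hlo, Finset.sum_image hinj]
    simp [lifts, numCompatible]
  | cons b l ih =>
    obtain ⟨b, rfl⟩ := Nat.exists_eq_add_of_le' (hl b (by simp)).1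
    have hb : b < n := (hl (b + 1) (by simp)).2
    rw [card_lifts_cons, hlo, Finset.sum_image hinj, numCompatible]
    refine Finset.sum_congr rfl fun g hg => ?_
    rw [Finset.mem_range] at hg
    refine ih ?_ hb (fun c hc => hl c (by simp [hc])) ?_ ?_
    · split_ifs <;> omega
    · rw [filter_Ico_eq_image ha hb (by omega)]
      simp only [Nat.add_lt_add_iff_right, show m - 1 - (m - 1 - g) = g by omega]
    · intro g' hg' g'' hg'' h
      simp only [Finset.coe_range, Set.mem_Iio] at hg' hg''
      have := Nat.eq_of_mul_eq_mul_right (by omega) (Nat.add_right_cancel h)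
      split_ifs at hg' hg'' <;> omega

theorem card_lifts {n m : ℕ} {π : List ℕ} (hne : π ≠ []) (hπ : ∀ c ∈ π, 1 ≤ c ∧ c ≤ n) :
    (lifts n (m * n) 0 π).card = numCompatible π m := by
  rcases π with _ | ⟨a, l⟩
  · exact absurd rfl hne
  obtain ⟨a, rfl⟩ := Nat.exists_eq_add_of_le' (hπ a (by simp)).1
  have ha : a < n := (hπ (a + 1) (by simp)).2
  refine card_lifts_aux le_rfl ha (fun c hc => hπ c (by simp [hc])) ?_
  rcases Nat.eq_zero_or_pos m with rfl | hm
  · simp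
  · have := filter_Ico_eq_image (n := n) (m := m) (k := 0) (i := 0) (by omega) ha hm
    rw [zero_mul, zero_add] at this
    rw [this, if_neg (by omega), show m - 1 - 0 + 1 = m by omega]

end Lifts

/-! ### Counting noncrossing arcs through the queue -/

section Arcs

variable {n m : ℕ}

/-- The point of the residue class `i` modulo `n` in the block `a i`. -/
def point (a : Fin n → Fin m) (i : Fin n) : ℕ := a i * n + i

theorem point_mod (a : Fin n → Fin m) (i : Fin n) : point a i % n = i := by
  rw [point, Nat.mul_add_mod', Nat.mod_eq_of_lt i.2]

theorem point_div (a : Fin n → Fin m) (i : Fin n) : point a i / n = a i := by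
  rw [point, Nat.mul_comm, Nat.mul_add_div (Nat.zero_lt_of_lt i.2), Nat.div_eq_of_lt i.2, add_zero]

theorem point_lt (a : Fin n → Fin m) (i : Fin n) : point a i < m * n := by
  have := Nat.mul_le_mul_right n (show (a i : ℕ) + 1 ≤ m by omega)
  rw [add_mul] at this
  unfold point; omega

theorem point_ne (a b : Fin n → Fin m) {i j : Fin n} (h : i ≠ j) : point a i ≠ point b j := by
  intro e
  have h1 := point_mod a i
  have h2 := point_mod b j
  rw [e, h2] at h1
  exact h (Fin.ext h1.symm)

theorem point_injective (a : Fin n → Fin m) : Function.Injective (point a) := by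
  intro i j h
  by_contra hij
  exact point_ne a a hij h

/-- The arcs joining `point a i` and `point b i` are pairwise noncrossing. -/
def Noncrossing (a b : Fin n → Fin m) : Prop :=
  (∀ i, a i ≤ b i) ∧
    ∀ i j, ¬ (point a i < point a j ∧ point a j < point b i ∧ point b i < point b j)

/-- The condition for all customers to be served in time. -/
def Parking (a : Fin n → Fin m) (x : Fin n → ℕ) : Prop :=
  ∀ r < m, ∑ i with m - 1 - (a i : ℕ) ≤ r, x i ≤ r

theorem noncrossing_iff_laminar (a b : Fin n → Fin m) :
    Noncrossing a b ↔ Laminar (point a) (point b) := by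
  have h1 : ∀ i, a i ≤ b i ↔ point a i ≤ point b i := by
    intro i
    rw [point, point, mul_add_le_mul_add_iff i.2 i.2, Fin.le_def]
    omega
  unfold Noncrossing Laminar
  refine and_congr (forall_congr' h1) (forall₂_congr fun i j => ?_)
  rcases eq_or_ne i j with rfl | hij
  · omega
  · have := point_ne b a hij
    omega

/-- The total work is a multiple of `n` and `i ≤ n - 1`, so the deadline `m * n - 1` on points
amounts to the deadline `m - 1` on blocks. -/
theorem parking_iff (a : Fin n → Fin m) (x : Fin n → ℕ) : Parking a x ↔
    ∀ i, point a i + ∑ j with point a i ≤ point a j, n * x j ≤ m * n - 1 := by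
  have hle : ∀ i, (point a i + ∑ j with point a i ≤ point a j, n * x j ≤ m * n - 1) ↔
      (a i : ℕ) + ∑ j with point a i ≤ point a j, x j ≤ m - 1 := by
    intro i
    have hi := i.2
    have hm := (a i).2
    have e1 : m * n - 1 = (m - 1) * n + (n - 1) := by
      have := Nat.succ_mul (m - 1) n
      rw [Nat.succ_eq_add_one, show m - 1 + 1 = m by omega] at this
      omega
    rw [← Finset.mul_sum, e1, point, mul_comm n,
      show ∀ s : ℕ, (a i : ℕ) * n + i + s * n = (a i + s) * n + i by intro s; ring,
      mul_add_le_mul_add_iff hi (by omega)]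
    omega
  simp only [hle]
  constructor
  · intro h i
    have h1 := h (m - 1 - a i) (by omega)
    have h2 : ∑ j with point a i ≤ point a j, x j ≤
        ∑ j with m - 1 - (a j : ℕ) ≤ m - 1 - (a i : ℕ), x j := by
      refine Finset.sum_le_sum_of_subset fun j hj => ?_
      simp only [Finset.mem_filter, Finset.mem_univ, true_and] at hj ⊢
      rw [point, point, mul_add_le_mul_add_iff i.2 j.2] at hj
      omega
    omega
  · intro h r hr
    rcases (Finset.univ.filter fun i => m - 1 - (a i : ℕ) ≤ r).eq_empty_or_nonempty with e | e
    · rw [e]; exact Nat.zero_le r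
    -- The earliest arrival in the last `r + 1` blocks: its backlog includes all of theirs.
    · obtain ⟨i, hi, hmin⟩ := Finset.exists_min_image _ (point a) e
      have h2 : ∑ j with m - 1 - (a j : ℕ) ≤ r, x j ≤ ∑ j with point a i ≤ point a j, x j :=
        Finset.sum_le_sum_of_subset fun j hj => by simpa using hmin j hj
      have := h i
      simp only [Finset.mem_filter, Finset.mem_univ, true_and] at hi
      omega

theorem Parking.lt {a : Fin n → Fin m} {x : Fin n → ℕ} (h : Parking a x) (i : Fin n) :
    x i < m := by
  have hm := (a i).2
  have h1 : ∑ j with m - 1 - (a j : ℕ) ≤ m - 1, x j ≤ m - 1 := h (m - 1) (by omega)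
  have h2 : x i ≤ ∑ j with m - 1 - (a j : ℕ) ≤ m - 1, x j :=
    Finset.single_le_sum (f := x) (by simp) (by simp)
  omega

/-- The service requirements, in blocks, for which the arcs are the sojourns in the queue. -/
def service [NeZero m] (a b : Fin n → Fin m) (i : Fin n) : Fin m :=
  Fin.ofNat m (exclusive (point a) (point b) i / n)

/-- The blocks of the departures in the queue with arrivals `a` and service requirements `x`. -/
def departureBlock [NeZero m] (a x : Fin n → Fin m) (i : Fin n) : Fin m :=
  Fin.ofNat m (departure (point a) (fun i => n * (x i : ℕ)) i / n)

theorem Noncrossing.service [NeZero m] {a b : Fin n → Fin m} (h : Noncrossing a b) :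
    (fun i => n * (service a b i : ℕ)) = exclusive (point a) (point b) ∧
      Parking a fun i => QuasiStirling.service a b i := by
  rw [noncrossing_iff_laminar] at h
  have hp := point_injective a
  -- Both ends of an arc have the same residue, so sojourn times, and hence service times, are
  -- multiples of `n`.
  have hdvd : ∀ i, n ∣ exclusive (point a) (point b) i :=
    (h.balanced hp).dvd hp h.1 fun i => by
      rw [← Nat.modEq_iff_dvd' (h.1 i), Nat.ModEq, point_mod, point_mod]
  have hmul : (fun i => n * (exclusive (point a) (point b) i / n)) =
      exclusive (point a) (point b) := funext fun i => Nat.mul_div_cancel' (hdvd i)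
  have hpark : Parking a fun i => exclusive (point a) (point b) i / n := by
    rw [parking_iff]
    intro i
    have := exclusive_work_le hp h.1 (T := m * n - 1)
      (fun j => by have := point_lt b j; omega) i
    rwa [← hmul] at this
  have hval : ∀ i, (QuasiStirling.service a b i : ℕ) = exclusive (point a) (point b) i / n :=
    fun i => by
      -- The parking condition keeps the value below `m`, so the reduction in `Fin.ofNat` changes
      -- nothing.
      rw [QuasiStirling.service, Fin.val_ofNat, Nat.mod_eq_of_lt (hpark.lt i)]
  simp only [hval]
  exact ⟨hmul, hpark⟩

theorem Parking.departureBlock [NeZero m] {a x : Fin n → Fin m} (h : Parking a fun i => x i) :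
    point (departureBlock a x) = departure (point a) (fun i => n * (x i : ℕ)) ∧
      Noncrossing a (QuasiStirling.departureBlock a x) := by
  have h' := departure_le_of_work_le ((parking_iff _ _).1 h)
  have hmod : ∀ i, departure (point a) (fun i => n * (x i : ℕ)) i % n = i := by
    intro i
    rw [← departure_balanced (point a) _ i, work, ← Finset.mul_sum, Nat.add_mul_mod_self_left,
      point_mod]
  have hpt : point (QuasiStirling.departureBlock a x) =
      departure (point a) (fun i => n * (x i : ℕ)) := by
    funext i
    have h1 := h' i
    have h2 := point_lt a i
    rw [point, QuasiStirling.departureBlock, Fin.val_ofNat, Nat.mod_eq_of_lt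
      (Nat.div_lt_of_lt_mul (by rw [mul_comm n]; omega))]
    conv_lhs => rw [← hmod i]
    exact Nat.div_add_mod' _ _
  refine ⟨hpt, ?_⟩
  rw [noncrossing_iff_laminar, hpt]
  exact departure_laminar _ _

open Classical in
theorem card_noncrossing_eq_card_parking [NeZero m] :
    (Finset.univ.filter fun ab : (Fin n → Fin m) × (Fin n → Fin m) =>
      Noncrossing ab.1 ab.2).card =
    (Finset.univ.filter fun ax : (Fin n → Fin m) × (Fin n → Fin m) =>
      Parking ax.1 fun i => ax.2 i).card := by
  refine Finset.card_bij' (fun ab _ => (ab.1, service ab.1 ab.2))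
    (fun ax _ => (ax.1, departureBlock ax.1 ax.2)) ?_ ?_ ?_ ?_
  · intro ab h
    rw [Finset.mem_filter] at h ⊢
    exact ⟨Finset.mem_univ _, h.2.service.2⟩
  · intro ax h
    rw [Finset.mem_filter] at h ⊢
    exact ⟨Finset.mem_univ _, h.2.departureBlock.2⟩
  · rintro ⟨a, b⟩ h
    have h : Noncrossing a b := (Finset.mem_filter.1 h).2
    have e := h.service.2.departureBlock.1
    rw [h.service.1,
      ((noncrossing_iff_laminar a b).1 h).departure_exclusive (point_injective a)] at e
    refine Prod.ext rfl (funext fun i => Fin.ext ?_)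
    have := point_div (departureBlock a (service a b)) i
    rw [e, point_div] at this
    exact this.symm
  · rintro ⟨a, x⟩ h
    have h : Parking a fun i => (x i : ℕ) := (Finset.mem_filter.1 h).2
    have e := h.departureBlock.2.service.1
    rw [h.departureBlock.1, exclusive_departure (point_injective a)] at e
    exact Prod.ext rfl (funext fun i =>
      Fin.ext (Nat.eq_of_mul_eq_mul_left (Nat.zero_lt_of_lt i.2) (congrFun e i)))

open Classical in
theorem card_noncrossing : m *
    (Finset.univ.filter fun ab : (Fin n → Fin m) × (Fin n → Fin m) =>
      Noncrossing ab.1 ab.2).card = m ^ n * (m + n).choose (n + 1) := by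
  rcases m with _ | m
  · simp
  rw [card_noncrossing_eq_card_parking, Finset.card_filter, Fintype.sum_prod_type_right,
    ← sum_sub_sum n le_rfl, Finset.mul_sum, Finset.mul_sum]
  refine Finset.sum_congr rfl fun x _ => ?_
  rw [← card_parking, ← Finset.card_filter]
  congr 1
  -- Reversing the order of the blocks turns deadlines counted from the right into the condition of
  -- `card_parking`.
  have hrev : ∀ (c : Fin (m + 1)) (r : ℕ), (c.rev : ℕ) ≤ r ↔ m + 1 - 1 - (c : ℕ) ≤ r := by
    intro c r; rw [Fin.val_rev]; omega
  have hrev' : ∀ (c : Fin (m + 1)) (r : ℕ), m + 1 - 1 - (c.rev : ℕ) ≤ r ↔ (c : ℕ) ≤ r := by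
    intro c r; rw [Fin.val_rev]; omega
  refine Finset.card_nbij' (fun a i => ((a i).rev : Fin (m + 1)))
    (fun b i => Fin.rev (n := m + 1) (b i)) ?_ ?_ ?_ ?_
  · intro a ha
    have ha : Parking a fun i => x i := by simpa using ha
    simp only [Finset.coe_filter, Finset.mem_univ, true_and]
    intro r hr
    refine le_of_eq_of_le (Finset.sum_congr (Finset.filter_congr fun i _ => ?_) fun _ _ => rfl)
      (ha r hr)
    exact hrev (a i) r
  · intro b hb
    simp only [Finset.coe_filter, Finset.mem_univ, true_and, Set.mem_ofPred_eq] at hb ⊢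
    intro r hr
    refine le_of_eq_of_le (Finset.sum_congr (Finset.filter_congr fun i _ => ?_) fun _ _ => rfl)
      (hb r hr)
    exact hrev' (b i) r
  · intro a _; funext i; exact Fin.rev_rev _
  · intro b _; funext i; exact Fin.rev_rev (n := m + 1) _

end Arcs

/-! ### Quasi-Stirling permutations as noncrossing arcs -/

section Words

variable {n m : ℕ}

theorem mem_quasiStirling {π : List ℕ} :
    π ∈ quasiStirling n ↔ (π : Multiset ℕ) = doubled n ∧ Avoids π := by
  classical
  simp only [quasiStirling, Finset.mem_filter, Multiset.mem_toFinset, Multiset.mem_lists_iff]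
  rw [eq_comm]; rfl

theorem mem_doubled {c : ℕ} : c ∈ doubled n → 1 ≤ c ∧ c ≤ n := by
  intro h
  have := Multiset.mem_of_mem_nsmul h
  simpa using this

theorem card_doubled : (doubled n).card = 2 * n := by
  simp [doubled]

theorem count_doubled (i : Fin n) : (doubled n).count (i + 1 : ℕ) = 2 := by
  rw [doubled, Multiset.count_nsmul, Multiset.count_eq_one_of_mem (Finset.nodup _)]
  simp

/-- The endpoints of the arcs joining `point a i` and `point b i`. -/
def endpoints (a b : Fin n → Fin m) : Multiset ℕ := ∑ i, {point a i, point b i}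

theorem mem_endpoints {a b : Fin n → Fin m} {t : ℕ} :
    t ∈ endpoints a b ↔ ∃ i, t = point a i ∨ t = point b i := by
  simp [endpoints, Multiset.mem_sum]

theorem count_endpoints (a b : Fin n → Fin m) {i : Fin n} {t : ℕ} (ht : t % n = i) :
    (endpoints a b).count t = Multiset.count t {point a i, point b i} := by
  rw [endpoints, Multiset.count_sum', Finset.sum_eq_single i]
  · intro j _ hj
    rw [Multiset.count_eq_zero]
    simp only [Multiset.insert_eq_cons, Multiset.mem_cons, Multiset.mem_singleton]
    rintro (rfl | rfl)
    · rw [point_mod] at ht; exact hj (Fin.ext ht)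
    · rw [point_mod] at ht; exact hj (Fin.ext ht)
  · simp

theorem map_endpoints (a b : Fin n → Fin m) :
    (endpoints a b).map (fun t => t % n + 1) = doubled n := by
  have h : (endpoints a b).map (fun t => t % n + 1) = ∑ i : Fin n, 2 • {((i : ℕ) + 1)} := by
    rw [endpoints, ← Multiset.coe_mapAddMonoidHom, map_sum]
    refine Finset.sum_congr rfl fun i _ => ?_
    simp [point_mod, two_nsmul]
  rw [h, ← Finset.smul_sum, doubled, Fin.sum_univ_eq_sum_range (fun i => ({i + 1} : Multiset ℕ)),
    ← Finset.sum_multiset_singleton (Finset.Icc 1 n), Finset.range_eq_Ico,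
    Finset.sum_Ico_add' (fun i => ({i} : Multiset ℕ)) 0 n 1]
  rfl

theorem point_le_point {a b : Fin n → Fin m} {i : Fin n} (h : a i ≤ b i) :
    point a i ≤ point b i :=
  (mul_add_le_mul_add_iff i.2 i.2).2 (by omega)

/-- The residue tells which arc an endpoint belongs to, and the order tells which end it is. -/
theorem endpoints_injective {a b a' b' : Fin n → Fin m} (h : ∀ i, a i ≤ b i)
    (h' : ∀ i, a' i ≤ b' i) (e : endpoints a b = endpoints a' b') : a = a' ∧ b = b' := by
  have key : ∀ i, a i = a' i ∧ b i = b' i := by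
    intro i
    have hmem : ∀ t, t % n = i →
        (t = point a i ∨ t = point b i ↔ t = point a' i ∨ t = point b' i) := by
      intro t ht
      have e2 := count_endpoints a b ht
      rw [e, count_endpoints a' b' ht] at e2
      have := congrArg (0 < ·) e2
      simpa [Multiset.count_pos, eq_comm] using this.symm
    have h1 := hmem _ (point_mod a i)
    have h2 := hmem _ (point_mod b i)
    have h3 := hmem _ (point_mod a' i)
    have h4 := hmem _ (point_mod b' i)
    have e1 := point_div a i
    have e2 := point_div b i
    have e3 := point_div a' i
    have e4 := point_div b' i
    have hi := point_le_point (h i)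
    have hi' := point_le_point (h' i)
    have g1 : point a i = point a' i := by omega
    have g2 : point b i = point b' i := by omega
    rw [g1] at e1
    rw [g2] at e2
    exact ⟨by omega, by omega⟩
  exact ⟨funext fun i => (key i).1, funext fun i => (key i).2⟩

theorem avoids_iff_noncrossing {a b : Fin n → Fin m} (hab : ∀ i, a i ≤ b i) {w : List ℕ}
    (hw : w.Pairwise (· ≤ ·)) (hM : (w : Multiset ℕ) = endpoints a b) :
    Avoids (w.map fun t => t % n + 1) ↔ Noncrossing a b := by
  have hmem : ∀ t, t ∈ w ↔ ∃ i, t = point a i ∨ t = point b i := by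
    intro t; rw [← mem_endpoints, ← hM, Multiset.mem_coe]
  constructor
  · refine fun h => ⟨hab, fun i j ⟨h1, h2, h3⟩ => ?_⟩
    have hsub : [point a i, point a j, point b i, point b j].Sublist w := by
      refine List.sublist_of_subperm_of_pairwise (r := (· ≤ ·)) (List.subperm_of_subset ?_ ?_) ?_ hw
      · simp; omega
      · intro t ht
        rw [hmem]
        simp only [List.mem_cons, List.not_mem_nil, or_false] at ht
        rcases ht with rfl | rfl | rfl | rfl
        · exact ⟨i, .inl rfl⟩
        · exact ⟨j, .inl rfl⟩
        · exact ⟨i, .inr rfl⟩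
        · exact ⟨j, .inr rfl⟩
      · simp; omega
    have hsub' := hsub.map fun t => t % n + 1
    simp only [List.map_cons, List.map_nil, point_mod] at hsub'
    rcases lt_trichotomy (i : ℕ) j with hij | hij | hij
    · exact (h (i + 1) (j + 1) (by omega)).1 hsub'
    · rw [Fin.ext hij] at h1; exact lt_irrefl _ h1
    · exact (h (j + 1) (i + 1) (by omega)).2 hsub'
  · intro h
    have key : ∀ α β : ℕ, α ≠ β → ¬ [α, β, α, β].Sublist (w.map fun t => t % n + 1) := by
      intro α β hαβ hsub
      obtain ⟨l, hl, e⟩ := List.sublist_map_iff.1 hsub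
      obtain _ | ⟨s₁, _ | ⟨s₂, _ | ⟨s₃, _ | ⟨s₄, _ | ⟨s₅, l⟩⟩⟩⟩⟩ := l
      all_goals
        simp only [List.map_cons, List.map_nil, List.cons.injEq, and_true, reduceCtorEq,
          and_false] at e
      have hp := hw.sublist hl
      simp only [List.pairwise_cons, List.mem_cons, List.not_mem_nil, or_false, forall_eq_or_imp,
        forall_eq] at hp
      have hm : ∀ t ∈ [s₁, s₂, s₃, s₄], ∃ i, t = point a i ∨ t = point b i :=
        fun t ht => (hmem t).1 (hl.subset ht)
      have hmod : ∀ (t : ℕ) (i : Fin n), (t = point a i ∨ t = point b i) → t % n = i := by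
        rintro t i (rfl | rfl)
        · exact point_mod a i
        · exact point_mod b i
      obtain ⟨i, hi⟩ := hm s₁ (by simp)
      obtain ⟨j, hj⟩ := hm s₂ (by simp)
      obtain ⟨i', hi'⟩ := hm s₃ (by simp)
      obtain ⟨j', hj'⟩ := hm s₄ (by simp)
      have r1 := hmod _ _ hi
      have r2 := hmod _ _ hj
      have r3 := hmod _ _ hi'
      have r4 := hmod _ _ hj'
      obtain rfl : i = i' := Fin.ext (by omega)
      obtain rfl : j = j' := Fin.ext (by omega)
      -- Neighbours have different residues, so the four points increase strictly and are the ends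
      -- of arcs `i` and `j` in crossing order.
      have n12 : s₁ ≠ s₂ := by rintro rfl; omega
      have n23 : s₂ ≠ s₃ := by rintro rfl; omega
      have n34 : s₃ ≠ s₄ := by rintro rfl; omega
      have l1 := point_le_point (hab i)
      have l2 := point_le_point (hab j)
      exact h.2 i j (by omega)
    exact fun α β hαβ => ⟨key α β hαβ.ne, key β α hαβ.ne'⟩

theorem exists_endpoints_eq (hn : 0 < n) {w : List ℕ} (hT : ∀ t ∈ w, t < m * n)
    (hw : (w.map (fun t => t % n + 1) : Multiset ℕ) = doubled n) :
    ∃ a b : Fin n → Fin m, (∀ i, a i ≤ b i) ∧ endpoints a b = w := by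
  have h : ∀ i : Fin n, ∃ s t : Fin m, s ≤ t ∧
      (w : Multiset ℕ).filter (fun u => i + 1 = u % n + 1) = {(s * n + i : ℕ), (t * n + i : ℕ)} := by
    intro i
    have h1 := count_doubled i
    rw [← hw, ← Multiset.map_coe, Multiset.count_map] at h1
    obtain ⟨s, t, e⟩ := Multiset.card_eq_two.1 h1
    wlog hst : s ≤ t generalizing s t
    · exact this t s (by rw [e, Multiset.pair_comm]) (by omega)
    have hs : s ∈ (w : Multiset ℕ).filter (fun u => i + 1 = u % n + 1) := by rw [e]; simp
    have ht : t ∈ (w : Multiset ℕ).filter (fun u => i + 1 = u % n + 1) := by rw [e]; simp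
    rw [Multiset.mem_filter, Multiset.mem_coe] at hs ht
    refine ⟨⟨s / n, Nat.div_lt_of_lt_mul (by rw [mul_comm]; exact hT s hs.1)⟩,
      ⟨t / n, Nat.div_lt_of_lt_mul (by rw [mul_comm]; exact hT t ht.1)⟩,
      Nat.div_le_div_right hst, ?_⟩
    have e1 := Nat.div_add_mod' s n
    have e2 := Nat.div_add_mod' t n
    rw [e]
    simp only [show (i : ℕ) = s % n by omega, e1]
    rw [show s % n = t % n by omega, e2]
  choose a b hab e using h
  refine ⟨a, b, hab, ?_⟩
  ext t
  have ht : t % n = (⟨t % n, Nat.mod_lt t hn⟩ : Fin n) := rfl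
  rw [count_endpoints a b ht, point, point, ← e, Multiset.count_filter_of_pos (p := fun u => t % n + 1 = u % n + 1) rfl]

open Classical in
theorem sum_card_lifts (hn : 0 < n) : ∑ π ∈ quasiStirling n, (lifts n (m * n) 0 π).card =
    (Finset.univ.filter fun ab : (Fin n → Fin m) × (Fin n → Fin m) =>
      Noncrossing ab.1 ab.2).card := by
  rw [← Finset.card_biUnion]
  · symm
    have hmem : ∀ w, w ∈ (quasiStirling n).biUnion (lifts n (m * n) 0) ↔
        w.map (fun t => t % n + 1) ∈ quasiStirling n ∧ w.Pairwise (· ≤ ·) ∧ ∀ t ∈ w, t < m * n := by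
      intro w
      simp only [Finset.mem_biUnion, mem_lifts, Nat.zero_le, true_and]
      exact ⟨fun ⟨π, h, e, h'⟩ => ⟨e ▸ h, h'⟩, fun ⟨h, h'⟩ => ⟨_, h, rfl, h'⟩⟩
    refine Finset.card_bij (fun ab _ => (endpoints ab.1 ab.2).sort (· ≤ ·)) ?_ ?_ ?_
    · rintro ⟨a, b⟩ h
      simp only [Finset.mem_filter, Finset.mem_univ, true_and] at h
      rw [hmem, mem_quasiStirling, avoids_iff_noncrossing h.1 (Multiset.pairwise_sort _ _)
        (Multiset.sort_eq _ _), ← Multiset.map_coe, Multiset.sort_eq, map_endpoints]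
      refine ⟨⟨rfl, h⟩, Multiset.pairwise_sort _ _, fun t ht => ?_⟩
      rw [Multiset.mem_sort, mem_endpoints] at ht
      obtain ⟨i, rfl | rfl⟩ := ht
      · exact point_lt a i
      · exact point_lt b i
    · rintro ⟨a, b⟩ h ⟨a', b'⟩ h' e
      simp only [Finset.mem_filter, Finset.mem_univ, true_and] at h h'
      have e' := congrArg (fun l : List ℕ => (l : Multiset ℕ)) e
      simp only [Multiset.sort_eq] at e'
      obtain ⟨rfl, rfl⟩ := endpoints_injective h.1 h'.1 e'
      rfl
    · intro w hw
      rw [hmem, mem_quasiStirling] at hw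
      obtain ⟨⟨h1, h2⟩, h3, h4⟩ := hw
      obtain ⟨a, b, hab, e⟩ := exists_endpoints_eq hn h4 h1
      refine ⟨(a, b), ?_, ?_⟩
      · simpa using (avoids_iff_noncrossing hab h3 e.symm).1 h2
      · refine List.Perm.eq_of_pairwise' (Multiset.pairwise_sort _ _) h3 ?_
        rw [← Multiset.coe_eq_coe, Multiset.sort_eq, e]
  · intro π _ π' _ hne
    rw [Function.onFun, Finset.disjoint_left]
    intro w hw hw'
    exact hne ((mem_lifts.1 hw).1.symm.trans (mem_lifts.1 hw').1)

theorem mul_sum_numCompatible (hn : 0 < n) (m : ℕ) :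
    m * ∑ π ∈ quasiStirling n, numCompatible π m = m ^ n * (m + n).choose (n + 1) := by
  rw [← card_noncrossing, ← sum_card_lifts hn]
  congr 1
  refine Finset.sum_congr rfl fun π hπ => ?_
  have h := (mem_quasiStirling.1 hπ).1
  refine (card_lifts ?_ fun c hc => mem_doubled (h ▸ Multiset.mem_coe.2 hc)).symm
  rintro rfl
  have := congrArg Multiset.card h
  rw [card_doubled] at this
  simp at this; omega

theorem length_of_mem_quasiStirling (hn : 0 < n) {π : List ℕ} (hπ : π ∈ quasiStirling n) :
    π.length = 2 * n ∧ π ≠ [] := by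
  have := congrArg Multiset.card (mem_quasiStirling.1 hπ).1
  rw [card_doubled, Multiset.coe_card] at this
  exact ⟨this, by rintro rfl; simp at this; omega⟩

theorem sum_numCompatible (hn : 0 < n) (m : ℕ) :
    ((∑ π ∈ quasiStirling n, numCompatible π m : ℕ) : ℚ) =
      (m : ℚ) ^ n / ((n : ℚ) + 1) * ((m + n).choose m : ℚ) := by
  -- The count is known only after multiplication by `m`, so `m = 0` needs its own argument.
  rcases Nat.eq_zero_or_pos m with rfl | hm
  · rw [Finset.sum_eq_zero, Nat.cast_zero, zero_pow hn.ne']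
    · simp
    · intro π hπ
      obtain ⟨a, l, rfl⟩ := List.exists_cons_of_ne_nil (length_of_mem_quasiStirling hn hπ).2
      exact numCompatible_zero a l
  · have h1 := mul_sum_numCompatible hn m
    have h2 := Nat.choose_succ_right_eq (m + n) n
    rw [Nat.add_sub_cancel, ← Nat.choose_symm_add] at h2
    generalize ∑ π ∈ quasiStirling n, numCompatible π m = N at *
    have h1' : (m : ℚ) * N = m ^ n * (m + n).choose (n + 1) := by exact_mod_cast h1
    have h2' : ((m + n).choose (n + 1) : ℚ) * (n + 1) = (m + n).choose m * m := by
      exact_mod_cast h2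
    have hm' : (m : ℚ) ≠ 0 := by positivity
    have hn' : (n : ℚ) + 1 ≠ 0 := by positivity
    rw [div_mul_eq_mul_div, eq_div_iff hn']
    apply mul_left_cancel₀ hm'
    linear_combination ((n : ℚ) + 1) * h1' + (m : ℚ) ^ n * h2'

end Words

/-! ### The generating function identity -/

theorem mk_eq_quasiStirlingPoly_mul_inv (n : ℕ) :
    PowerSeries.mk (fun m : ℕ => (m : ℚ) ^ n / ((n : ℚ) + 1) * ((m + n).choose m : ℚ)) =
      (quasiStirlingPoly n : ℚ⟦X⟧) *
        ((1 - (PowerSeries.X : ℚ⟦X⟧)) ^ (2 * n + 1))⁻¹ := by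
  rw [PowerSeries.eq_mul_inv_iff_mul_eq (by simp)]
  -- For `n = 0` the only word is empty, with no final descent, and the series is `1 / (1 - t)`; the
  -- encoding needs `n > 0`.
  rcases Nat.eq_zero_or_pos n with rfl | hn
  · have : quasiStirling 0 = {[]} := by
      ext π
      rw [mem_quasiStirling, Finset.mem_singleton]
      constructor
      · rintro ⟨h, -⟩
        simpa [doubled] using h
      · rintro rfl
        exact ⟨by simp [doubled], fun a b _ => by simp⟩
    rw [quasiStirlingPoly, this, Finset.sum_singleton]
    simp only [des, pow_zero, Nat.add_zero, Nat.choose_self, Nat.cast_zero, Nat.cast_one, mul_zero,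
      zero_add, pow_one, div_one, mul_one, Polynomial.coe_one]
    exact PowerSeries.mk_one_mul_one_sub_eq_one ℚ
  · have h1 : PowerSeries.mk
        (fun m : ℕ => (m : ℚ) ^ n / ((n : ℚ) + 1) * ((m + n).choose m : ℚ)) =
        ∑ π ∈ quasiStirling n, PowerSeries.mk fun m => (numCompatible π m : ℚ) := by
      ext m
      rw [map_sum, PowerSeries.coeff_mk, ← sum_numCompatible hn m]
      simp
    have h2 : (quasiStirlingPoly n : ℚ⟦X⟧) =
        ∑ π ∈ quasiStirling n, (PowerSeries.X : ℚ⟦X⟧) ^ des π := by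
      rw [quasiStirlingPoly, ← Polynomial.coeToPowerSeries.ringHom_apply, map_sum]
      simp
    rw [h1, h2, Finset.sum_mul]
    refine Finset.sum_congr rfl fun π hπ => ?_
    obtain ⟨hlen, hne⟩ := length_of_mem_quasiStirling hn hπ
    obtain ⟨a, l, rfl⟩ := List.exists_cons_of_ne_nil hne
    rw [← mk_numCompatible_mul, mul_comm, show 2 * n + 1 = l.length + 2 by
      rw [← hlen, List.length_cons]]

end QuasiStirling

theorem theorem2p4 (n : ℕ) :
    PowerSeries.mk (fun m : ℕ => (m : ℚ) ^ n / ((n : ℚ) + 1) * ((m + n).choose m : ℚ)) =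
      (QuasiStirling.quasiStirlingPoly n : ℚ⟦X⟧) *
        ((1 - (PowerSeries.X : ℚ⟦X⟧)) ^ (2 * n + 1))⁻¹ := by
  exact QuasiStirling.mk_eq_quasiStirlingPoly_mul_inv n
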